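/- Let $n\ge 1$. A quantum graph $\mathcal G=(\mathcal S,\mathcal M,M_n)$ consists of a von Neumann algebra $\mathcal M\subseteq M_n=M_n(\mathbb C)$ and a linear subspace $\mathcal S\subseteq M_n$ that is closed under adjoints, is a bimodule over the commutant $\mathcal M'$, and is orthogonal to $\mathcal M'$ with respect to the trace. A finite von Neumann algebra is one acting on a separable Hilbert space and having a faithful normal tracial state. For a type $t\in\{loc,q,qa,qc\}$ and a finite von Neumann algebra $\mathcal N$, call $\mathcal N$ of type $t$ if $\dim\mathcal N=1$ (for $t=loc$), $\dim\mathcal N<\infty$ (for $t=q$), $\mathcal N$ has an injective trace-preserving $*$-homomorphism into an ultrapower $\mathcal R^\omega$ of the hyperfinite $\mathrm{II}_1$ factor (for $t=qa$), without further condition for $t=qc$. A $t$-coloring of $\mathcal G$ with $c$ colors is a family of projections $P_1,\dots,P_c\in\mathcal M\bar\otimes\mathcal N$, with $\mathcal N$ of type $t$, such that $\sum_a P_a=I$ and $P_a(X\otimes I_{\mathcal N})P_a=0$ for all $a$ and all $X\in\mathcal S$. A $t$-$b$-fold coloring with $c$ colors ($b\ge 0$) is a family of pairwise commuting projections $P_1,\dots,P_c\in\mathcal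 M\bar\otimes\mathcal N$, with $\mathcal N$ of type $t$, such that $$\sum_{\{a_1,\dots,a_b\}\in\binom{[c]}{b}}P_{a_1}\cdots P_{a_b}=I$$ and $P_a(X\otimes I_{\mathcal N})P_a=0$ for all $a$ and all $X\in\mathcal S$. Let $\chi_t(\mathcal G)$ and $\chi_{b,t}(\mathcal G)$ in $\mathbb N\cup\{\infty\}$ be the least number of colors of a $t$-coloring and of a $t$-$b$-fold coloring, respectively, and $\infty$ if there is none. For a finite simple graph $G$, let $\chi_b(G)$ be the least $c$ for which one can assign to every vertex a $b$-element subset of $\{1,\dots,c\}$ so that adjacent vertices get disjoint subsets. The quantum graph associated to a graph $G$ with vertices $v_1,\dots,v_n$ is $(\operatorname{span}\{E_{i,j}: v_i\sim v_j\},D_n,M_n)$, where $D_n$ is the algebra of diagonal matrices. Then: 1. $\chi_t(\mathcal G)=\chi_{1,t}(\mathcal G)$ for every quantum graph $\mathcal G$ and every $t\in\{loc,q,qa,qc\}$. 2. If $\mathcal G$ is the quantum graph associated to a graph $G$, then $\chi_{b,loc}(\mathcal G)=\chi_b(G)$ for every $b$. 3. For every quantum graph $\mathcal G$, every $b\ge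 1$ and every $t\in\{loc,q,qa,qc\}$, we have $\chi_{b-1,t}(\mathcal G)<\chi_{b,t}(\mathcal G)$, unless both numbers are infinite. -/

import Mathlib

open scoped Topology ComplexOrder

noncomputable section

/-! ### Finite von Neumann algebras -/

/-- `τ` is a faithful normal tracial state on the von Neumann algebra `N`.  Positivity and the order
used for normality refer to the usual (Loewner) order of bounded operators. -/
structure IsFaithfulNormalTrace {K : Type} [NormedAddCommGroup K] [InnerProductSpace ℂ K]
    [CompleteSpace K] (N : VonNeumannAlgebra K) (τ : N.toStarSubalgebra →ₗ[ℂ] ℂ) : Prop where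
  map_one : τ 1 = 1
  nonneg : ∀ x : N.toStarSubalgebra, 0 ≤ (x : K →L[ℂ] K) → 0 ≤ τ x
  tracial : ∀ x y, τ (x * y) = τ (y * x)
  faithful : ∀ x, τ (star x * x) = 0 → x = 0
  /-- The state preserves suprema of directed sets of self-adjoint elements. -/
  normal : ∀ (D : Set N.toStarSubalgebra) (s : N.toStarSubalgebra), D.Nonempty →
    (∀ x ∈ D, IsSelfAdjoint x) → DirectedOn (· ≤ ·) D → IsLUB D s →
      IsLUB ((fun x => (τ x).re) '' D) (τ s).re

/-- A von Neumann algebra on a separable Hilbert space is finite if it carries a faithful normal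
tracial state. -/
def IsFiniteVN {K : Type} [NormedAddCommGroup K] [InnerProductSpace ℂ K] [CompleteSpace K]
    (N : VonNeumannAlgebra K) : Prop :=
  TopologicalSpace.SeparableSpace K ∧ ∃ τ, IsFaithfulNormalTrace N τ

/-- `R` is the hyperfinite II₁ factor: an infinite-dimensional factor on a separable Hilbert space
that has a faithful normal tracial state and is generated, as a von Neumann algebra, by an
increasing sequence of finite-dimensional `*`-subalgebras. -/
structure IsHyperfiniteIIOneFactor {K : Type} [NormedAddCommGroup K] [InnerProductSpace ℂ K]
    [CompleteSpace K] (R : VonNeumannAlgebra K) : Prop where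
  finite : IsFiniteVN R
  infinite_dim : ¬ FiniteDimensional ℂ R.toStarSubalgebra
  factor : ∀ x ∈ R, (∀ y ∈ R, x * y = y * x) → ∃ c : ℂ, x = c • (1 : K →L[ℂ] K)
  hyperfinite : ∃ A : ℕ → StarSubalgebra ℂ (K →L[ℂ] K), Monotone A ∧
    (∀ n, FiniteDimensional ℂ (A n)) ∧
    Set.centralizer (Set.centralizer (⋃ n, (A n : Set (K →L[ℂ] K)))) = (R : Set (K →L[ℂ] K))

/-! ### Tracial ultrapowers -/

section Ultrapower

variable {K : Type} [NormedAddCommGroup K] [InnerProductSpace ℂ K] [CompleteSpace K]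

/-- The `*`-algebra of norm-bounded sequences in `R`. -/
def boundedSeq (R : VonNeumannAlgebra K) : StarSubalgebra ℂ (ℕ → R.toStarSubalgebra) where
  carrier := {x | ∃ C : ℝ, ∀ n, ‖(x n : K →L[ℂ] K)‖ ≤ C}
  mul_mem' := by
    rintro x y ⟨C, hC⟩ ⟨D, hD⟩
    refine ⟨C * D, fun n => ?_⟩
    calc ‖((x n * y n : R.toStarSubalgebra) : K →L[ℂ] K)‖
        ≤ ‖(x n : K →L[ℂ] K)‖ * ‖(y n : K →L[ℂ] K)‖ := norm_mul_le _ _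
      _ ≤ C * D := mul_le_mul (hC n) (hD n) (norm_nonneg _) ((norm_nonneg _).trans (hC n))
  add_mem' := by
    rintro x y ⟨C, hC⟩ ⟨D, hD⟩
    exact ⟨C + D, fun n => (norm_add_le _ _).trans (add_le_add (hC n) (hD n))⟩
  algebraMap_mem' := fun c =>
    ⟨‖algebraMap ℂ (K →L[ℂ] K) c‖, fun _ => le_rfl⟩
  star_mem' := by
    rintro x ⟨C, hC⟩
    exact ⟨C, fun n => (norm_star (x n : K →L[ℂ] K)).trans_le (hC n)⟩

/-- Along `ω`, the sequence `x` tends to zero in the `2`-norm `‖a‖₂ = τ(a* a) ^ (1/2)`. -/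
def IsTraceNull {R : VonNeumannAlgebra K} (τ : R.toStarSubalgebra →ₗ[ℂ] ℂ) (ω : Ultrafilter ℕ)
    (x : boundedSeq R) : Prop :=
  Filter.Tendsto (fun n => (τ (star (x.1 n) * x.1 n)).re) ω (𝓝 0)

lemma star_mul_le_norm_sq (A X : K →L[ℂ] K) :
    0 ≤ ((‖A‖ ^ 2 : ℝ) : ℂ) • (star X * X) - star (A * X) * (A * X) := by
  rw [ContinuousLinearMap.nonneg_iff_isPositive, ContinuousLinearMap.isPositive_iff_complex]
  intro v
  have hs : ∀ Y : K →L[ℂ] K, inner ℂ ((star Y * Y) v) v = ((‖Y v‖ ^ 2 : ℝ) : ℂ) := by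
    intro Y
    change inner ℂ (ContinuousLinearMap.adjoint Y (Y v)) v = _
    rw [ContinuousLinearMap.adjoint_inner_left, inner_self_eq_norm_sq_to_K]
    simp
  have e : inner ℂ ((((‖A‖ ^ 2 : ℝ) : ℂ) • (star X * X) - star (A * X) * (A * X)) v) v =
      ((‖A‖ ^ 2 * ‖X v‖ ^ 2 - ‖A (X v)‖ ^ 2 : ℝ) : ℂ) := by
    change inner ℂ (((‖A‖ ^ 2 : ℝ) : ℂ) • (star X * X) v - (star (A * X) * (A * X)) v) v = _
    rw [inner_sub_left, inner_smul_left, hs, hs, Complex.conj_ofReal]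
    push_cast
    rfl
  rw [e]
  have h2 : ‖A (X v)‖ ^ 2 ≤ (‖A‖ * ‖X v‖) ^ 2 :=
    pow_le_pow_left₀ (norm_nonneg _) (A.le_opNorm (X v)) 2
  rw [mul_pow] at h2
  refine ⟨rfl, ?_⟩
  change 0 ≤ ‖A‖ ^ 2 * ‖X v‖ ^ 2 - ‖A (X v)‖ ^ 2
  linarith

namespace IsFaithfulNormalTrace

variable {R : VonNeumannAlgebra K} {τ : R.toStarSubalgebra →ₗ[ℂ] ℂ}

lemma re_nonneg (hτ : IsFaithfulNormalTrace R τ) (x : R.toStarSubalgebra) :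
    0 ≤ (τ (star x * x)).re := by
  have h : (0 : K →L[ℂ] K) ≤ ((star x * x : R.toStarSubalgebra) : K →L[ℂ] K) :=
    star_mul_self_nonneg (x : K →L[ℂ] K)
  exact (Complex.nonneg_iff.1 (hτ.nonneg _ h)).1

lemma re_star (hτ : IsFaithfulNormalTrace R τ) (x : R.toStarSubalgebra) :
    (τ (star (star x) * star x)).re = (τ (star x * x)).re := by
  rw [star_star, hτ.tracial]

lemma re_add_le (hτ : IsFaithfulNormalTrace R τ) (x y : R.toStarSubalgebra) :
    (τ (star (x + y) * (x + y))).re ≤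
      2 * (τ (star x * x)).re + 2 * (τ (star y * y)).re := by
  have h := hτ.re_nonneg (x - y)
  have e : star (x + y) * (x + y) =
      star x * x + star x * x + (star y * y + star y * y) - star (x - y) * (x - y) := by
    simp only [star_add, star_sub]
    noncomm_ring
  rw [e]
  simp only [map_sub τ (_ + _), map_add, Complex.sub_re, Complex.add_re]
  linarith

lemma re_mul_le (hτ : IsFaithfulNormalTrace R τ) (a x : R.toStarSubalgebra) :
    (τ (star (a * x) * (a * x))).re ≤ ‖(a : K →L[ℂ] K)‖ ^ 2 * (τ (star x * x)).re := by
  have key : (0 : K →L[ℂ] K) ≤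
      ((((‖(a : K →L[ℂ] K)‖ ^ 2 : ℝ) : ℂ) • (star x * x) - star (a * x) * (a * x) :
        R.toStarSubalgebra) : K →L[ℂ] K) :=
    star_mul_le_norm_sq (a : K →L[ℂ] K) (x : K →L[ℂ] K)
  have h := (Complex.nonneg_iff.1 (hτ.nonneg _ key)).1
  rw [map_sub, map_smul, smul_eq_mul, Complex.sub_re, Complex.re_ofReal_mul] at h
  linarith

end IsFaithfulNormalTrace

namespace IsTraceNull

variable {R : VonNeumannAlgebra K} {τ : R.toStarSubalgebra →ₗ[ℂ] ℂ} {ω : Ultrafilter ℕ}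
  {x y : boundedSeq R}

lemma zero : IsTraceNull τ ω (0 : boundedSeq R) := by
  have : ∀ n : ℕ, (τ (star ((0 : boundedSeq R).1 n) * (0 : boundedSeq R).1 n)).re = 0 := by
    intro n
    change (τ (star 0 * 0)).re = 0
    simp
  exact tendsto_const_nhds.congr fun n => (this n).symm

lemma add (hτ : IsFaithfulNormalTrace R τ) (hx : IsTraceNull τ ω x) (hy : IsTraceNull τ ω y) :
    IsTraceNull τ ω (x + y) := by
  have h0 := (Filter.Tendsto.const_mul 2 hx).add (Filter.Tendsto.const_mul 2 hy)
  rw [mul_zero, add_zero] at h0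
  exact squeeze_zero (fun n => hτ.re_nonneg _) (fun n => hτ.re_add_le _ _) h0

lemma neg (hx : IsTraceNull τ ω x) : IsTraceNull τ ω (-x) := by
  refine Filter.Tendsto.congr (fun n => ?_) hx
  change _ = (τ (star (-(x.1 n)) * -(x.1 n))).re
  rw [star_neg, neg_mul_neg]

lemma mul_left (hτ : IsFaithfulNormalTrace R τ) (hy : IsTraceNull τ ω y) :
    IsTraceNull τ ω (x * y) := by
  obtain ⟨C, hC⟩ := x.2
  have h0 : Filter.Tendsto (fun n => C ^ 2 * (τ (star (y.1 n) * y.1 n)).re) ω (𝓝 0) := by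
    simpa using Filter.Tendsto.const_mul (C ^ 2) hy
  refine squeeze_zero (fun n => hτ.re_nonneg _) (fun n => (hτ.re_mul_le _ _).trans ?_) h0
  exact mul_le_mul_of_nonneg_right (pow_le_pow_left₀ (norm_nonneg _) (hC n) 2) (hτ.re_nonneg _)

lemma star (hτ : IsFaithfulNormalTrace R τ) (hx : IsTraceNull τ ω x) :
    IsTraceNull τ ω (star x) :=
  hx.congr fun n => (hτ.re_star (x.1 n)).symm

lemma mul_right (hτ : IsFaithfulNormalTrace R τ) (hx : IsTraceNull τ ω x) :
    IsTraceNull τ ω (x * y) := by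
  have h := (((hx.star hτ).mul_left (x := Star.star y) hτ)).star hτ
  rwa [star_mul, star_star, star_star] at h

end IsTraceNull

/-- The two-sided ideal of bounded sequences that tend to zero in `2`-norm along `ω`. -/
def traceNullIdeal {R : VonNeumannAlgebra K} {τ : R.toStarSubalgebra →ₗ[ℂ] ℂ}
    (hτ : IsFaithfulNormalTrace R τ) (ω : Ultrafilter ℕ) : TwoSidedIdeal (boundedSeq R) :=
  TwoSidedIdeal.mk' {x | IsTraceNull τ ω x} IsTraceNull.zero (fun hx hy => hx.add hτ hy)
    (fun hx => hx.neg) (fun hy => hy.mul_left hτ) (fun hx => hx.mul_right hτ)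

lemma mem_traceNullIdeal {R : VonNeumannAlgebra K} {τ : R.toStarSubalgebra →ₗ[ℂ] ℂ}
    (hτ : IsFaithfulNormalTrace R τ) (ω : Ultrafilter ℕ) (x : boundedSeq R) :
    x ∈ traceNullIdeal hτ ω ↔ IsTraceNull τ ω x := by
  unfold traceNullIdeal
  rw [TwoSidedIdeal.mem_mk']
  rfl

/-- The tracial ultrapower `R^ω`. -/
abbrev TracialUltrapower {R : VonNeumannAlgebra K} {τ : R.toStarSubalgebra →ₗ[ℂ] ℂ}
    (hτ : IsFaithfulNormalTrace R τ) (ω : Ultrafilter ℕ) : Type :=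
  (traceNullIdeal hτ ω).ringCon.Quotient

/-- The involution of `R^ω`, induced by the pointwise involution of sequences. -/
instance TracialUltrapower.instStar {R : VonNeumannAlgebra K} {τ : R.toStarSubalgebra →ₗ[ℂ] ℂ}
    (hτ : IsFaithfulNormalTrace R τ) (ω : Ultrafilter ℕ) : Star (TracialUltrapower hτ ω) where
  star := Quotient.map' star (by
    intro x y hxy
    have h1 : (traceNullIdeal hτ ω).ringCon x y := hxy
    rw [TwoSidedIdeal.rel_iff, mem_traceNullIdeal] at h1
    change (traceNullIdeal hτ ω).ringCon (star x) (star y)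
    rw [TwoSidedIdeal.rel_iff, mem_traceNullIdeal]
    have h2 := h1.star hτ
    rwa [star_sub] at h2)

/-- `N` embeds into `R^ω`: for some faithful normal tracial state `σ` on `N` there is an injective
trace-preserving `*`-homomorphism from `N` into a tracial ultrapower, along a free ultrafilter `ω`
on `ℕ`, of the hyperfinite II₁ factor `R`.  The trace of the class of a bounded sequence `y` in
`R^ω` is the limit along `ω` of the traces of its terms. -/
def EmbedsInUltrapower (N : VonNeumannAlgebra K) : Prop :=
  ∃ (L : Type) (_ : NormedAddCommGroup L) (_ : InnerProductSpace ℂ L) (_ : CompleteSpace L)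
    (R : VonNeumannAlgebra L) (τ : R.toStarSubalgebra →ₗ[ℂ] ℂ) (hτ : IsFaithfulNormalTrace R τ)
    (ω : Ultrafilter ℕ) (σ : N.toStarSubalgebra →ₗ[ℂ] ℂ)
    (π : N.toStarSubalgebra →⋆ₐ[ℂ] TracialUltrapower hτ ω),
    IsHyperfiniteIIOneFactor R ∧ (ω : Filter ℕ) ≤ Filter.cofinite ∧ IsFaithfulNormalTrace N σ ∧
      Function.Injective π ∧
      ∀ (x : N.toStarSubalgebra) (y : boundedSeq R), (y : TracialUltrapower hτ ω) = π x →
        Filter.Tendsto (fun n => τ (y.1 n)) ω (𝓝 (σ x))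

end Ultrapower

/-! ### Quantum graphs -/

/-- An irreflexive quantum graph `(S, M, M_n)`, the matrix size being the cardinality of `ι`. -/
structure QuantumGraph (ι : Type*) [Fintype ι] [DecidableEq ι] where
  /-- the von Neumann algebra of the quantum graph -/
  M : StarSubalgebra ℂ (Matrix ι ι ℂ)
  /-- the operator space of the quantum graph -/
  S : Submodule ℂ (Matrix ι ι ℂ)
  bicommutant : Set.centralizer (Set.centralizer (M : Set (Matrix ι ι ℂ))) = M
  star_mem : ∀ X ∈ S, star X ∈ S
  mul_mem_left : ∀ Y ∈ Set.centralizer (M : Set (Matrix ι ι ℂ)), ∀ X ∈ S, Y * X ∈ S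
  mul_mem_right : ∀ Y ∈ Set.centralizer (M : Set (Matrix ι ι ℂ)), ∀ X ∈ S, X * Y ∈ S
  /-- `S` is orthogonal to the commutant of `M` with respect to the trace. -/
  perp : ∀ Y ∈ Set.centralizer (M : Set (Matrix ι ι ℂ)), ∀ X ∈ S, (star Y * X).trace = 0

section Coloring

variable {ι : Type*} [Fintype ι] [DecidableEq ι]

/-- The `*`-algebra of diagonal matrices. -/
def diagonalMatrices (ι : Type*) [Fintype ι] [DecidableEq ι] :
    StarSubalgebra ℂ (Matrix ι ι ℂ) where
  carrier := {A | A.IsDiag}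
  mul_mem' := by
    intro A B hA hB
    rw [Set.mem_ofPred_eq, Matrix.isDiag_iff_diagonal_diag] at hA hB
    rw [Set.mem_ofPred_eq, ← hA, ← hB, Matrix.diagonal_mul_diagonal]
    exact Matrix.isDiag_diagonal _
  add_mem' := fun hA hB => Matrix.IsDiag.add hA hB
  algebraMap_mem' := fun c => by
    rw [Matrix.algebraMap_eq_diagonal]
    exact Matrix.isDiag_diagonal _
  star_mem' := fun hA => Matrix.IsDiag.conjTranspose hA

lemma centralizer_diagonalMatrices :
    Set.centralizer (diagonalMatrices ι : Set (Matrix ι ι ℂ)) = {A | A.IsDiag} := by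
  ext A
  constructor
  · intro hA i j hij
    have h := hA (Matrix.diagonal (Pi.single i 1)) (Matrix.isDiag_diagonal _)
    have h2 := congrFun (congrFun h i) j
    simpa [Matrix.diagonal_mul, Matrix.mul_diagonal, hij] using h2
  · intro hA B hB
    have hB' : B.IsDiag := hB
    rw [Set.mem_ofPred_eq, Matrix.isDiag_iff_diagonal_diag] at hA
    rw [Matrix.isDiag_iff_diagonal_diag] at hB'
    rw [← hA, ← hB', Matrix.diagonal_mul_diagonal, Matrix.diagonal_mul_diagonal]
    simp only [mul_comm]

/-- The span of the matrix units `E i j` over the ordered edges `(i, j)` of a simple graph. -/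
def edgeSpan (G : SimpleGraph ι) : Submodule ℂ (Matrix ι ι ℂ) :=
  Submodule.span ℂ {X | ∃ i j, G.Adj i j ∧ X = Matrix.single i j 1}

lemma mem_edgeSpan (G : SimpleGraph ι) (X : Matrix ι ι ℂ) :
    X ∈ edgeSpan G ↔ ∀ i j, ¬ G.Adj i j → X i j = 0 := by
  constructor
  · intro hX i j hij
    induction hX using Submodule.span_induction with
    | mem x hx =>
      obtain ⟨k, l, hkl, rfl⟩ := hx
      rw [Matrix.single_apply, if_neg]
      rintro ⟨rfl, rfl⟩
      exact hij hkl
    | zero => rfl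
    | add x y _ _ hx hy => simp [hx, hy]
    | smul c x _ hx => simp [hx]
  · intro hX
    rw [Matrix.matrix_eq_sum_single X]
    refine Submodule.sum_mem _ fun i _ => Submodule.sum_mem _ fun j _ => ?_
    by_cases hij : G.Adj i j
    · have : Matrix.single i j (X i j) = X i j • Matrix.single i j (1 : ℂ) := by simp
      rw [this]
      exact Submodule.smul_mem _ _ (Submodule.subset_span ⟨i, j, hij, rfl⟩)
    · rw [hX i j hij]
      simp

/-- The quantum graph `(S_G, D_n, M_n)` associated to a classical graph. -/
def SimpleGraph.toQuantumGraph (G : SimpleGraph ι) : QuantumGraph ι where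
  M := diagonalMatrices ι
  S := edgeSpan G
  bicommutant := by
    rw [centralizer_diagonalMatrices]
    exact centralizer_diagonalMatrices
  star_mem := by
    intro X hX
    rw [mem_edgeSpan] at hX ⊢
    intro i j hij
    simp [Matrix.star_apply, hX j i (fun h => hij h.symm)]
  mul_mem_left := by
    intro Y hY X hX
    rw [centralizer_diagonalMatrices, Set.mem_ofPred_eq, Matrix.isDiag_iff_diagonal_diag] at hY
    rw [mem_edgeSpan] at hX ⊢
    intro i j hij
    rw [← hY, Matrix.diagonal_mul, hX i j hij, mul_zero]
  mul_mem_right := by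
    intro Y hY X hX
    rw [centralizer_diagonalMatrices, Set.mem_ofPred_eq, Matrix.isDiag_iff_diagonal_diag] at hY
    rw [mem_edgeSpan] at hX ⊢
    intro i j hij
    rw [← hY, Matrix.mul_diagonal, hX i j hij, zero_mul]
  perp := by
    intro Y hY X hX
    rw [centralizer_diagonalMatrices, Set.mem_ofPred_eq, Matrix.isDiag_iff_diagonal_diag] at hY
    rw [mem_edgeSpan] at hX
    rw [← hY, Matrix.star_eq_conjTranspose, Matrix.diagonal_conjTranspose]
    simp [Matrix.trace, Matrix.diagonal_mul, hX _ _ (G.loopless.irrefl _)]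

/-! ### Colorings -/

/-- The four types of colorings: local, quantum, quantum approximate, quantum commuting. -/
inductive ColoringType
  | loc
  | q
  | qa
  | qc

variable {K : Type} [NormedAddCommGroup K] [InnerProductSpace ℂ K] [CompleteSpace K]

/-- `N` is a finite von Neumann algebra of the kind allowed for colorings of type `t`. -/
def ColoringType.Allows (t : ColoringType) (N : VonNeumannAlgebra K) : Prop :=
  IsFiniteVN N ∧
    match t with
    | .loc => Module.finrank ℂ N.toStarSubalgebra = 1
    | .q => FiniteDimensional ℂ N.toStarSubalgebra
    | .qa => EmbedsInUltrapower N
    | .qc => True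

/-- The elementary tensor `m ⊗ x`, as a matrix of operators on `K`; here `M_n(B(K))` is identified
with `B(ℂⁿ ⊗ K)`. -/
def elemTensor (m : Matrix ι ι ℂ) (x : K →L[ℂ] K) : Matrix ι ι (K →L[ℂ] K) :=
  Matrix.of fun i j => m i j • x

/-- The von Neumann tensor product `M ⊗ N`: the double commutant, in `M_n(B(K)) = B(ℂⁿ ⊗ K)`, of the
set of elementary tensors. -/
def vnTensor (M : StarSubalgebra ℂ (Matrix ι ι ℂ)) (N : VonNeumannAlgebra K) :
    Set (Matrix ι ι (K →L[ℂ] K)) :=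
  Set.centralizer (Set.centralizer {A | ∃ m ∈ M, ∃ x ∈ N, A = elemTensor m x})

/-- `P` is a coloring of the quantum graph `𝒢`, with projections in `M ⊗ N`. -/
structure IsColoring (𝒢 : QuantumGraph ι) (N : VonNeumannAlgebra K) {c : ℕ}
    (P : Fin c → Matrix ι ι (K →L[ℂ] K)) : Prop where
  mem : ∀ a, P a ∈ vnTensor 𝒢.M N
  proj : ∀ a, IsStarProjection (P a)
  sum_eq_one : ∑ a, P a = 1
  edge : ∀ a, ∀ X ∈ 𝒢.S, P a * elemTensor X 1 * P a = 0

/-- `P` is a `b`-fold coloring of the quantum graph `𝒢`, with projections in `M ⊗ N`. -/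
structure IsBFoldColoring (𝒢 : QuantumGraph ι) (N : VonNeumannAlgebra K) (b : ℕ) {c : ℕ}
    (P : Fin c → Matrix ι ι (K →L[ℂ] K)) : Prop where
  mem : ∀ a, P a ∈ vnTensor 𝒢.M N
  proj : ∀ a, IsStarProjection (P a)
  comm : ∀ a a', Commute (P a) (P a')
  sum_eq_one : ∑ T ∈ (Finset.univ : Finset (Fin c)).powersetCard b,
    T.noncommProd P (fun a _ a' _ _ => comm a a') = 1
  edge : ∀ a, ∀ X ∈ 𝒢.S, P a * elemTensor X 1 * P a = 0

/-- `𝒢` has a coloring of type `t` with `c` colors. -/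
def QuantumGraph.Colorable (𝒢 : QuantumGraph ι) (t : ColoringType) (c : ℕ) : Prop :=
  ∃ (K : Type) (_ : NormedAddCommGroup K) (_ : InnerProductSpace ℂ K) (_ : CompleteSpace K)
    (N : VonNeumannAlgebra K) (P : Fin c → Matrix ι ι (K →L[ℂ] K)),
    t.Allows N ∧ IsColoring 𝒢 N P

/-- `𝒢` has a `b`-fold coloring of type `t` with `c` colors. -/
def QuantumGraph.BFoldColorable (𝒢 : QuantumGraph ι) (b : ℕ) (t : ColoringType) (c : ℕ) : Prop :=
  ∃ (K : Type) (_ : NormedAddCommGroup K) (_ : InnerProductSpace ℂ K) (_ : CompleteSpace K)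
    (N : VonNeumannAlgebra K) (P : Fin c → Matrix ι ι (K →L[ℂ] K)),
    t.Allows N ∧ IsBFoldColoring 𝒢 N b P

/-- The chromatic number `χ_t(𝒢)`, infinite if there is no coloring of type `t`. -/
def QuantumGraph.chromaticNumber (𝒢 : QuantumGraph ι) (t : ColoringType) : ℕ∞ :=
  ⨅ c ∈ {c : ℕ | 𝒢.Colorable t c}, (c : ℕ∞)

/-- The `b`-fold chromatic number `χ_{b,t}(𝒢)`, infinite if there is no `b`-fold coloring of
type `t`. -/
def QuantumGraph.bFoldChromaticNumber (𝒢 : QuantumGraph ι) (b : ℕ) (t : ColoringType) : ℕ∞ :=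
  ⨅ c ∈ {c : ℕ | 𝒢.BFoldColorable b t c}, (c : ℕ∞)

end Coloring

/-- A classical graph has a `b`-fold coloring with `c` colors: every vertex gets `b` of the `c`
colors, adjacent vertices getting disjoint sets of colors. -/
def SimpleGraph.BFoldColorable {V : Type*} (G : SimpleGraph V) (b c : ℕ) : Prop :=
  ∃ φ : V → Finset (Fin c), (∀ v, (φ v).card = b) ∧ ∀ v w, G.Adj v w → Disjoint (φ v) (φ w)

/-- The classical `b`-fold chromatic number. -/
def SimpleGraph.bFoldChromaticNumber {V : Type*} (G : SimpleGraph V) (b : ℕ) : ℕ∞ :=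
  ⨅ c ∈ {c : ℕ | G.BFoldColorable b c}, (c : ℕ∞)

end

noncomputable section

/-! ### Counting with families of commuting idempotents -/

section Counting

variable {α A : Type*} [Fintype α] [DecidableEq α] [CommRing A]

/-! Commuting idempotents `p a` split the unit into the atoms `atomOf p T`, one for each set `T` of
colors, on which `p a` acts as 1 if `a ∈ T` and as 0 otherwise. The left side of the `b`-fold
identity acts on such an atom as the number `T.card.choose b`, so for `b ≥ 1` the identity forces
`T.card = b` on every nonzero atom.

Strict growth is the classical trick of deleting the largest color of each vertex, done atom by atom
with `dropMax`. The last color never survives, so `c + 1` colors of multiplicity `b + 1` become `c`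
colors of multiplicity `b` (`sum_powersetCard_prod_dropMax`, `exists_dropMax`). The new projections
are multiples of the old ones in the ring these generate, so membership and the edge condition
persist over the same `N`, whatever the type.

For `b = 1`, projections with sum 1 are pairwise orthogonal (`mul_eq_zero_of_sum_eq_one`), hence
commute, and both notions of coloring coincide.

For a classical graph and a one-dimensional `N`, elements of the tensor product are scalar functions
on the vertices (`exists_diagonalScalar`). Projections are then indicator functions, that is, an
assignment of color sets, and the same count gives their sizes. -/

omit [Fintype α] in
lemma prod_mul_of_mul_eq_ite (f : α → A) (e : A) (T : Finset α)
    (h : ∀ a, f a * e = if a ∈ T then e else 0) (S : Finset α) :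
    (∏ a ∈ S, f a) * e = if S ⊆ T then e else 0 := by
  induction S using Finset.induction_on with
  | empty => simp
  | insert a S ha ih =>
    rw [Finset.prod_insert ha, mul_assoc, ih]
    simp only [Finset.insert_subset_iff]
    by_cases hS : S ⊆ T <;> simp [hS, h]

/-- Only the `k`-subsets of `T` contribute, each of them one copy of `e`. -/
lemma sum_powersetCard_prod_mul (f : α → A) (e : A) (T : Finset α)
    (h : ∀ a, f a * e = if a ∈ T then e else 0) (k : ℕ) :
    (∑ S ∈ (Finset.univ : Finset α).powersetCard k, ∏ a ∈ S, f a) * e =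
      T.card.choose k • e := by
  rw [Finset.sum_mul, Finset.sum_congr rfl fun S _ => prod_mul_of_mul_eq_ite f e T h S,
    ← Finset.sum_filter, Finset.sum_const, ← Finset.card_powersetCard]
  congr 2
  ext S
  simp [Finset.mem_powersetCard, and_comm]

/-- The minimal idempotent attached to the set `T` by a family `p` of idempotents. -/
def atomOf (p : α → A) (T : Finset α) : A := (∏ a ∈ T, p a) * ∏ a ∈ Finset.univ \ T, (1 - p a)

lemma sum_atomOf (p : α → A) : ∑ T : Finset α, atomOf p T = 1 := by
  have h := Finset.prod_add p (fun a => 1 - p a) Finset.univ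
  simpa [atomOf] using h.symm

lemma mul_atomOf (p : α → A) (hp : ∀ a, p a * p a = p a) (T : Finset α) (a : α) :
    p a * atomOf p T = if a ∈ T then atomOf p T else 0 := by
  unfold atomOf
  split_ifs with ha
  · rw [← Finset.mul_prod_erase T p ha, ← mul_assoc, ← mul_assoc, hp]
  · have ha' : a ∈ Finset.univ \ T := by simp [ha]
    rw [← Finset.mul_prod_erase _ (fun a => 1 - p a) ha']
    have : p a * (1 - p a) = 0 := by rw [mul_sub, mul_one, hp, sub_self]
    calc _ = (p a * (1 - p a)) * ((∏ a ∈ T, p a) *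
          ∏ x ∈ (Finset.univ \ T).erase a, (1 - p x)) := by ring
      _ = 0 := by rw [this, zero_mul]

/-- The idempotent obtained from `p a` by removing the part on which `a` is the largest index. -/
def dropMax {c : ℕ} (p : Fin (c + 1) → A) (a : Fin c) : A :=
  p a.castSucc * (1 - ∏ i ∈ Finset.Ioi a.castSucc, (1 - p i))

/-- On the atom of `T` the product over `i > a` acts as 1 exactly when no element of `T` exceeds
`a`; hence `dropMax p` selects `T` without its maximum. -/
lemma dropMax_mul_atomOf {c : ℕ} (p : Fin (c + 1) → A) (hp : ∀ a, p a * p a = p a)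
    (T : Finset (Fin (c + 1))) (a : Fin c) :
    dropMax p a * atomOf p T =
      if a ∈ Finset.univ.filter (fun a : Fin c => a.castSucc ∈ T ∧ ∃ i ∈ T, a.castSucc < i)
        then atomOf p T else 0 := by
  have h1 : ∀ i, (1 - p i) * atomOf p T = if i ∈ Finset.univ \ T then atomOf p T else 0 := by
    intro i
    rw [sub_mul, one_mul, mul_atomOf p hp]
    by_cases hi : i ∈ T <;> simp [hi]
  have h2 := prod_mul_of_mul_eq_ite _ _ _ h1 (Finset.Ioi a.castSucc)
  have h3 : Finset.Ioi a.castSucc ⊆ Finset.univ \ T ↔ ¬ ∃ i ∈ T, a.castSucc < i := by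
    simp only [Finset.subset_iff, Finset.mem_Ioi, Finset.mem_sdiff, Finset.mem_univ, true_and,
      not_exists, not_and]
    exact forall_congr' fun i => ⟨fun h hi hl => h hl hi, fun h hl hi => h hi hl⟩
  rw [dropMax, mul_assoc, sub_mul, one_mul, h2]
  simp only [h3, Finset.mem_filter, Finset.mem_univ, true_and]
  by_cases hT : ∃ i ∈ T, a.castSucc < i
  · simp [hT, mul_atomOf p hp]
  · simp [hT]

/-- `Fin.castSucc` maps the filtered set onto `T` minus its maximum: the last index lies below no
element, so nothing is lost in `Fin c`. -/
lemma card_filter_castSucc_lt {c : ℕ} (T : Finset (Fin (c + 1))) (hT : T.Nonempty) :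
    (Finset.univ.filter
      (fun a : Fin c => a.castSucc ∈ T ∧ ∃ i ∈ T, a.castSucc < i)).card = T.card - 1 := by
  rw [← Finset.card_erase_of_mem (T.max'_mem hT), ← Finset.card_map Fin.castSuccEmb]
  congr 1
  ext i
  simp only [Finset.mem_map, Finset.mem_filter, Finset.mem_univ, true_and, Finset.mem_erase,
    Fin.coe_castSuccEmb]
  constructor
  · rintro ⟨a, ⟨ha, j, hj, hlt⟩, rfl⟩
    exact ⟨(hlt.trans_le (T.le_max' j hj)).ne, ha⟩
  · rintro ⟨hne, hi⟩
    have hlt : i < T.max' hT := lt_of_le_of_ne (T.le_max' i hi) hne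
    have hl : i ≠ Fin.last c := (hlt.trans_le (Fin.le_last _)).ne
    refine ⟨i.castPred hl, ⟨?_, T.max' hT, T.max'_mem hT, ?_⟩, ?_⟩ <;> simp [hi, hlt]

/-- The identity is compared atom by atom. The condition `htf` excludes torsion, so that a binomial
coefficient acting as 1 on a nonzero atom equals 1. -/
lemma sum_powersetCard_prod_dropMax {c : ℕ} (htf : ∀ (n : ℕ) (x : A), n • x = x → n = 1 ∨ x = 0)
    (p : Fin (c + 1) → A) (hp : ∀ a, p a * p a = p a) (k : ℕ)
    (h : ∑ S ∈ (Finset.univ : Finset (Fin (c + 1))).powersetCard (k + 1), ∏ a ∈ S, p a = 1) :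
    ∑ S ∈ (Finset.univ : Finset (Fin c)).powersetCard k, ∏ a ∈ S, dropMax p a = 1 := by
  rw [← mul_one (∑ S ∈ _, _), ← sum_atomOf p, Finset.mul_sum]
  refine Finset.sum_congr rfl fun T _ => ?_
  rw [sum_powersetCard_prod_mul _ _ _ (dropMax_mul_atomOf p hp T)]
  have h1 := sum_powersetCard_prod_mul _ _ _ (mul_atomOf p hp T) (k + 1)
  rw [h, one_mul] at h1
  obtain h2 | h2 := htf _ _ h1.symm
  · have hT : T.card = k + 1 := by
      -- The other alternative, `k + 1 = 0`, is impossible; multiplicity 0 would give no control of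
      -- `T.card`.
      rw [Nat.choose_eq_one_iff] at h2
      simpa using h2
    rw [card_filter_castSucc_lt T (Finset.card_pos.1 (by omega)), hT]
    simp
  · simp [h2]

lemma dropMax_mul_self {c : ℕ} (p : Fin (c + 1) → A) (hp : ∀ a, p a * p a = p a) (a : Fin c) :
    dropMax p a * dropMax p a = dropMax p a := by
  have h : IsIdempotentElem (∏ i ∈ Finset.Ioi a.castSucc, (1 - p i)) := by
    rw [IsIdempotentElem, ← Finset.prod_mul_distrib]
    exact Finset.prod_congr rfl fun i _ => (IsIdempotentElem.one_sub (hp i)).eq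
  exact (IsIdempotentElem.mul (hp _) h.one_sub).eq

end Counting

/-! ### Lowering the multiplicity of a coloring -/

/-- The transfer to a noncommutative ring: the subring generated by the commuting `P a` is
commutative, and the count takes place there. The two-sided factorization of `Q a` through `P
a.castSucc` serves the edge condition. -/
lemma exists_dropMax {A : Type*} [Ring A] [StarRing A]
    (htf : ∀ (n : ℕ) (x : A), n • x = x → n = 1 ∨ x = 0) {c : ℕ} (P : Fin (c + 1) → A)
    (hP : ∀ a, IsStarProjection (P a)) (hcomm : ∀ a a', Commute (P a) (P a')) (k : ℕ)
    (h : ∑ T ∈ (Finset.univ : Finset (Fin (c + 1))).powersetCard (k + 1),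
      T.noncommProd P (fun a _ a' _ _ => hcomm a a') = 1) :
    ∃ (Q : Fin c → A) (hQ : ∀ a a', Commute (Q a) (Q a')),
      (∀ a, IsStarProjection (Q a)) ∧
      (∀ a, Q a ∈ Subring.closure (Set.range P)) ∧
      (∀ a, ∃ r, Q a = P a.castSucc * r ∧ Q a = r * P a.castSucc) ∧
      ∑ T ∈ (Finset.univ : Finset (Fin c)).powersetCard k,
        T.noncommProd Q (fun a _ a' _ _ => hQ a a') = 1 := by
  have hc : ∀ x ∈ Set.range P, ∀ y ∈ Set.range P, x * y = y * x := by
    rintro _ ⟨a, rfl⟩ _ ⟨a', rfl⟩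
    exact hcomm a a'
  let B := Subring.closure (Set.range P)
  have hcomm' : IsMulCommutative B := Subring.isMulCommutative_closure hc
  let _ : CommRing B := { (inferInstance : Ring B) with mul_comm := hcomm'.is_comm.comm }
  have hcB : ∀ x y : B, (x : A) * y = y * x := fun x y => congrArg Subtype.val (mul_comm x y)
  -- Integer polynomials in commuting self-adjoint elements are self-adjoint, so idempotents of `B`
  -- are projections.
  have hsa : ∀ x ∈ B, IsSelfAdjoint x := by
    intro x hx
    induction hx using Subring.closure_induction with
    | mem x hx =>
      obtain ⟨a, rfl⟩ := hx
      exact (hP a).isSelfAdjoint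
    | zero => exact IsSelfAdjoint.zero A
    | one => exact IsSelfAdjoint.one A
    | add x y _ _ hx hy => exact hx.add hy
    | neg x _ hx => exact hx.neg
    | mul x y hx' hy' hx hy =>
      rw [IsSelfAdjoint, star_mul, hx.star_eq, hy.star_eq]
      exact hcB ⟨y, hy'⟩ ⟨x, hx'⟩
  let p : Fin (c + 1) → B := fun a => ⟨P a, Subring.subset_closure ⟨a, rfl⟩⟩
  have hp : ∀ a, p a * p a = p a := fun a => Subtype.ext (hP a).isIdempotentElem
  have hprod : ∀ {d : ℕ} (f : Fin d → B) (S : Finset (Fin d)),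
      ((∏ a ∈ S, f a : B) : A) =
        S.noncommProd (fun a => (f a : A)) (fun a _ a' _ _ => hcB (f a) (f a')) := by
    intro d f S
    rw [← Finset.noncommProd_eq_prod]
    exact Finset.map_noncommProd S f _ B.subtype
  have hsum : ∀ {d : ℕ} (f : Fin d → B) (k : ℕ),
      ((∑ S ∈ (Finset.univ : Finset (Fin d)).powersetCard k, ∏ a ∈ S, f a : B) : A) =
        ∑ S ∈ (Finset.univ : Finset (Fin d)).powersetCard k,
          S.noncommProd (fun a => (f a : A)) (fun a _ a' _ _ => hcB (f a) (f a')) := by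
    intro d f k
    rw [← Finset.sum_congr rfl fun S _ => hprod f S]
    exact map_sum B.subtype _ _
  have hB : ∀ (n : ℕ) (x : B), n • x = x → n = 1 ∨ x = 0 := fun n x hx =>
    (htf n x (congrArg Subtype.val hx)).imp_right fun h => Subtype.ext h
  refine ⟨fun a => (dropMax p a : B), fun a a' => hcB _ _, fun a => ⟨?_, hsa _ (Subtype.prop _)⟩,
    fun a => Subtype.prop _, fun a => ⟨((1 - ∏ i ∈ Finset.Ioi a.castSucc, (1 - p i) : B) : A),
      rfl, ?_⟩, ?_⟩
  · exact congrArg Subtype.val (dropMax_mul_self p hp a)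
  · exact hcB (p a.castSucc) _
  · rw [← hsum (dropMax p) k, sum_powersetCard_prod_dropMax hB p hp k]
    · rfl
    · exact Subtype.ext ((hsum p (k + 1)).trans h)

section Coloring

variable {ι : Type*} [Fintype ι] [DecidableEq ι]
  {K : Type} [NormedAddCommGroup K] [InnerProductSpace ℂ K] [CompleteSpace K]

/-- The tensor product is a centralizer, hence a subring. -/
lemma closure_le_vnTensor (M : StarSubalgebra ℂ (Matrix ι ι ℂ)) (N : VonNeumannAlgebra K)
    {s : Set (Matrix ι ι (K →L[ℂ] K))} (hs : s ⊆ vnTensor M N) {x : Matrix ι ι (K →L[ℂ] K)}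
    (hx : x ∈ Subring.closure s) : x ∈ vnTensor M N := by
  have : Subring.closure s ≤ Subring.centralizer
      (Set.centralizer {A | ∃ m ∈ M, ∃ x ∈ N, A = elemTensor m x}) :=
    Subring.closure_le.2 hs
  exact this hx

omit [DecidableEq ι] [CompleteSpace K] in
lemma eq_one_or_eq_zero_of_nsmul_eq (n : ℕ) (x : Matrix ι ι (K →L[ℂ] K)) (h : n • x = x) :
    n = 1 ∨ x = 0 := by
  have h1 : ((n : ℂ) - 1) • x = 0 := by
    rw [sub_smul, one_smul, Nat.cast_smul_eq_nsmul, h, sub_self]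
  refine (smul_eq_zero.1 h1).imp_left fun h => ?_
  exact_mod_cast sub_eq_zero.1 h

lemma QuantumGraph.BFoldColorable.pred {𝒢 : QuantumGraph ι} {b : ℕ} {t : ColoringType} {c : ℕ}
    (h : 𝒢.BFoldColorable (b + 1) t (c + 1)) : 𝒢.BFoldColorable b t c := by
  obtain ⟨K, _, _, _, N, P, hN, hP⟩ := h
  obtain ⟨Q, hcomm, hproj, hmem, hr, hsum⟩ :=
    exists_dropMax eq_one_or_eq_zero_of_nsmul_eq P hP.proj hP.comm b hP.sum_eq_one
  refine ⟨K, _, _, _, N, Q, hN, fun a => ?_, hproj, hcomm, hsum, fun a X hX => ?_⟩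
  · refine closure_le_vnTensor 𝒢.M N ?_ (hmem a)
    rintro _ ⟨a, rfl⟩
    exact hP.mem a
  · obtain ⟨r, h1, h2⟩ := hr a
    -- Write the left factor as `r * P` and the right one as `P * r`.
    calc Q a * elemTensor X 1 * Q a
        = r * (P a.castSucc * elemTensor X 1 * P a.castSucc) * r := by
          nth_rw 1 [h2]
          rw [h1]
          noncomm_ring
      _ = 0 := by rw [hP.edge _ X hX, mul_zero, zero_mul]

lemma ColoringType.Allows.nontrivial {t : ColoringType} {N : VonNeumannAlgebra K}
    (h : t.Allows N) : Nontrivial K := by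
  obtain ⟨⟨-, τ, hτ⟩, -⟩ := h
  by_contra hK
  rw [not_nontrivial_iff_subsingleton] at hK
  have h1 : (1 : N.toStarSubalgebra) = 0 :=
    Subtype.ext (ContinuousLinearMap.ext fun x => Subsingleton.elim _ _)
  have h2 := hτ.map_one
  rw [h1, map_zero] at h2
  exact zero_ne_one h2

/-- Without colors the sum is empty, and `0 ≠ 1` because neither `ι` nor `K` is trivial. -/
lemma QuantumGraph.BFoldColorable.pos [Nonempty ι] {𝒢 : QuantumGraph ι} {b : ℕ} {t : ColoringType}
    {c : ℕ} (h : 𝒢.BFoldColorable (b + 1) t c) : 0 < c := by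
  obtain ⟨K, _, _, _, N, P, hN, hP⟩ := h
  have := hN.nontrivial
  rw [Nat.pos_iff_ne_zero]
  rintro rfl
  have h1 := hP.sum_eq_one
  rw [Finset.powersetCard_eq_empty.2 (by simp), Finset.sum_empty] at h1
  exact zero_ne_one h1

/-! ### Colorings and `1`-fold colorings -/

-- Each diagonal entry of the sum is a vanishing sum of positive operators `star y * y`, which
-- reduces the claim to the order on operators of `K`.
omit [DecidableEq ι] in
lemma matrix_eq_zero_of_sum_star_mul_self {κ : Type*} (s : Finset κ)
    (Y : κ → Matrix ι ι (K →L[ℂ] K)) (h : ∑ k ∈ s, star (Y k) * Y k = 0) (k : κ) (hk : k ∈ s) :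
    Y k = 0 := by
  ext1 l i
  have h1 : ∑ k ∈ s, ∑ l, star (Y k l i) * Y k l i = 0 := by
    have := congrFun (congrFun h i) i
    simpa [Matrix.sum_apply, Matrix.mul_apply, Matrix.star_apply] using this
  have h2 := (Finset.sum_eq_zero_iff_of_nonneg fun k _ => Finset.sum_nonneg fun l _ =>
    star_mul_self_nonneg (Y k l i)).1 h1 k hk
  have h3 := (Finset.sum_eq_zero_iff_of_nonneg fun l _ =>
    star_mul_self_nonneg (Y k l i)).1 h2 l (Finset.mem_univ l)
  exact (CStarRing.star_mul_self_eq_zero_iff _).1 h3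

/-- Compressing `∑ k, P k = 1` by `P a` and cancelling the term `k = a` leaves `∑ k ≠ a, star (P k *
P a) * (P k * P a) = 0`. -/
lemma mul_eq_zero_of_sum_eq_one {α : Type*} [Fintype α] [DecidableEq α]
    (P : α → Matrix ι ι (K →L[ℂ] K)) (hP : ∀ a, IsStarProjection (P a)) (h : ∑ a, P a = 1)
    (a a' : α) (hne : a' ≠ a) : P a' * P a = 0 := by
  refine matrix_eq_zero_of_sum_star_mul_self (Finset.univ.erase a) (fun k => P k * P a) ?_ a'
    (by simp [hne])
  have h1 : ∀ k, star (P k * P a) * (P k * P a) = P a * P k * P a := by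
    intro k
    rw [star_mul, (hP k).isSelfAdjoint.star_eq, (hP a).isSelfAdjoint.star_eq,
      mul_assoc, ← mul_assoc (P k), (hP k).isIdempotentElem.eq, mul_assoc]
  have h2 : ∑ k, P a * P k * P a = P a := by
    rw [← Finset.sum_mul, ← Finset.mul_sum, h, mul_one, (hP a).isIdempotentElem.eq]
  rw [← Finset.add_sum_erase _ _ (Finset.mem_univ a), (hP a).isIdempotentElem.eq,
    (hP a).isIdempotentElem.eq] at h2
  simp only [h1]
  simpa using h2

lemma sum_powersetCard_one_noncommProd {A : Type*} [Ring A] {c : ℕ} (P : Fin c → A)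
    (hcomm : ∀ a a', Commute (P a) (P a')) :
    ∑ T ∈ (Finset.univ : Finset (Fin c)).powersetCard 1,
      T.noncommProd P (fun a _ a' _ _ => hcomm a a') = ∑ a, P a := by
  rw [Finset.powersetCard_one, Finset.sum_map]
  simp

lemma QuantumGraph.colorable_iff (𝒢 : QuantumGraph ι) (t : ColoringType) (c : ℕ) :
    𝒢.Colorable t c ↔ 𝒢.BFoldColorable 1 t c := by
  constructor
  · rintro ⟨K, _, _, _, N, P, hN, hP⟩
    have hcomm : ∀ a a', Commute (P a) (P a') := by
      intro a a'
      by_cases hne : a = a'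
      · rw [hne]
      · rw [Commute, SemiconjBy, mul_eq_zero_of_sum_eq_one P hP.proj hP.sum_eq_one a' a hne,
          mul_eq_zero_of_sum_eq_one P hP.proj hP.sum_eq_one a a' (Ne.symm hne)]
    exact ⟨K, _, _, _, N, P, hN, hP.mem, hP.proj, hcomm,
      (sum_powersetCard_one_noncommProd P hcomm).trans hP.sum_eq_one, hP.edge⟩
  · rintro ⟨K, _, _, _, N, P, hN, hP⟩
    exact ⟨K, _, _, _, N, P, hN, hP.mem, hP.proj,
      (sum_powersetCard_one_noncommProd P hP.comm).symm.trans hP.sum_eq_one, hP.edge⟩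

end Coloring

/-! ### The scalars as a von Neumann algebra -/

lemma ContinuousLinearMap.eq_smul_one (x : ℂ →L[ℂ] ℂ) : x = x 1 • (1 : ℂ →L[ℂ] ℂ) := by
  ext
  simp

lemma ContinuousLinearMap.apply_one_mul (x y : ℂ →L[ℂ] ℂ) : (x * y) 1 = x 1 * y 1 := by
  change x (y 1) = _
  rw [x.eq_smul_one]
  simp

lemma ContinuousLinearMap.star_apply_one (x : ℂ →L[ℂ] ℂ) : (star x) 1 = star (x 1) := by
  conv_lhs => rw [x.eq_smul_one]
  simp

lemma ContinuousLinearMap.apply_one_nonneg {x : ℂ →L[ℂ] ℂ} (hx : 0 ≤ x) : 0 ≤ x 1 := by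
  rw [ContinuousLinearMap.nonneg_iff_isPositive] at hx
  simpa using hx.inner_nonneg_right 1

lemma ContinuousLinearMap.nonneg_of_apply_one {x : ℂ →L[ℂ] ℂ} (hx : 0 ≤ x 1) : 0 ≤ x := by
  rw [x.eq_smul_one]
  exact smul_nonneg hx (zero_le_one (α := ℂ →L[ℂ] ℂ))

/-- The von Neumann algebra of all operators on `ℂ`. -/
def scalarVN : VonNeumannAlgebra ℂ where
  toStarSubalgebra := ⊤
  centralizer_centralizer' := by
    refine Set.eq_univ_of_forall fun x y _ => ?_
    rw [x.eq_smul_one, y.eq_smul_one]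
    simp [smul_smul, mul_comm]

/-- The identification of the operators on `ℂ` with the scalars. -/
def scalarTrace : scalarVN.toStarSubalgebra →ₗ[ℂ] ℂ where
  toFun x := (x : ℂ →L[ℂ] ℂ) 1
  map_add' _ _ := rfl
  map_smul' _ _ := rfl

lemma isFaithfulNormalTrace_scalarTrace : IsFaithfulNormalTrace scalarVN scalarTrace where
  map_one := rfl
  nonneg x hx := ContinuousLinearMap.apply_one_nonneg hx
  tracial x y := by
    change ((x : ℂ →L[ℂ] ℂ) * (y : ℂ →L[ℂ] ℂ)) 1 = ((y : ℂ →L[ℂ] ℂ) * (x : ℂ →L[ℂ] ℂ)) 1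
    rw [ContinuousLinearMap.apply_one_mul, ContinuousLinearMap.apply_one_mul, mul_comm]
  faithful x hx := by
    have h : (star (x : ℂ →L[ℂ] ℂ) * (x : ℂ →L[ℂ] ℂ)) 1 = 0 := hx
    rw [ContinuousLinearMap.apply_one_mul, ContinuousLinearMap.star_apply_one] at h
    have h1 : (x : ℂ →L[ℂ] ℂ) 1 = 0 := by simpa using h
    refine Subtype.ext ((x : ℂ →L[ℂ] ℂ).eq_smul_one.trans ?_)
    rw [h1]
    exact zero_smul ℂ (1 : ℂ →L[ℂ] ℂ)
  normal D s _ hsa _ hs := by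
    have hmono : ∀ x y : scalarVN.toStarSubalgebra, x ≤ y →
        (scalarTrace x).re ≤ (scalarTrace y).re := by
      intro x y hxy
      have h : (0 : ℂ →L[ℂ] ℂ) ≤ (y : ℂ →L[ℂ] ℂ) - x := sub_nonneg.2 hxy
      have h1 := (Complex.nonneg_iff.1 (ContinuousLinearMap.apply_one_nonneg h)).1
      exact sub_nonneg.1 h1
    refine ⟨?_, fun u hu => ?_⟩
    · rintro _ ⟨x, hx, rfl⟩
      exact hmono x s (hs.1 hx)
    -- An upper bound `u` of the traces makes `u • 1` an upper bound of `D`, since self-adjoint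
    -- operators on `ℂ` are real scalars.
    · have hle : s ≤ (u : ℂ) • (1 : scalarVN.toStarSubalgebra) := by
        refine hs.2 fun x hx => ?_
        have h1 : ((x : ℂ →L[ℂ] ℂ) 1).re ≤ u := hu ⟨x, hx, rfl⟩
        have h2 : star (x : ℂ →L[ℂ] ℂ) = x := congrArg Subtype.val (hsa x hx)
        have h3 : ((x : ℂ →L[ℂ] ℂ) 1).im = 0 := by
          have h4 := ContinuousLinearMap.star_apply_one (x : ℂ →L[ℂ] ℂ)
          rw [h2] at h4
          exact Complex.conj_eq_iff_im.1 h4.symm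
        have h4 : (0 : ℂ →L[ℂ] ℂ) ≤ (u : ℂ) • 1 - (x : ℂ →L[ℂ] ℂ) := by
          refine ContinuousLinearMap.nonneg_of_apply_one ?_
          rw [Complex.nonneg_iff]
          simp [h1, h3]
        exact sub_nonneg.1 h4
      have h := hmono _ _ hle
      rw [map_smul, smul_eq_mul, show scalarTrace 1 = 1 from rfl] at h
      simpa using h

lemma allows_scalarVN : ColoringType.loc.Allows scalarVN := by
  refine ⟨⟨inferInstance, scalarTrace, isFaithfulNormalTrace_scalarTrace⟩, ?_⟩
  change Module.finrank ℂ scalarVN.toStarSubalgebra = 1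
  have h1 : (1 : scalarVN.toStarSubalgebra) ≠ 0 := fun h => by
    simpa using congrArg (fun x : scalarVN.toStarSubalgebra => (x : ℂ →L[ℂ] ℂ) 1) h
  rw [finrank_eq_one_iff_of_nonzero' 1 h1]
  exact fun x => ⟨(x : ℂ →L[ℂ] ℂ) 1, Subtype.ext (x : ℂ →L[ℂ] ℂ).eq_smul_one.symm⟩

/-! ### Local colorings of classical graphs -/

section Local

variable {ι : Type*} [Fintype ι] [DecidableEq ι]
  {K : Type} [NormedAddCommGroup K] [InnerProductSpace ℂ K] [CompleteSpace K]

variable (ι K) in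
/-- Scalar functions as diagonal matrices of operators. -/
def diagonalScalar : (ι → ℂ) →+* Matrix ι ι (K →L[ℂ] K) :=
  (Matrix.diagonalRingHom ι (K →L[ℂ] K)).comp ((algebraMap ℂ (K →L[ℂ] K)).compLeft ι)

omit [CompleteSpace K] in
lemma diagonalScalar_apply (f : ι → ℂ) :
    diagonalScalar ι K f = Matrix.diagonal fun i => algebraMap ℂ (K →L[ℂ] K) (f i) := rfl

omit [CompleteSpace K] in
lemma diagonalScalar_injective [Nontrivial K] : Function.Injective (diagonalScalar ι K) := by
  intro f g h
  ext i
  rw [diagonalScalar_apply, diagonalScalar_apply] at h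
  exact (algebraMap ℂ (K →L[ℂ] K)).injective (congrFun (Matrix.diagonal_injective h) i)

omit [CompleteSpace K] in
lemma diagonalScalar_eq_elemTensor (f : ι → ℂ) :
    diagonalScalar ι K f = elemTensor (Matrix.diagonal f) 1 := by
  ext1 i j
  by_cases h : i = j
  · subst h
    simp [diagonalScalar_apply, elemTensor, Algebra.algebraMap_eq_smul_one]
  · simp [diagonalScalar_apply, elemTensor, h]

omit [CompleteSpace K] in
lemma diagonalScalar_conj_apply (f : ι → ℂ) (X : Matrix ι ι ℂ) (i j : ι) :
    (diagonalScalar ι K f * elemTensor X 1 * diagonalScalar ι K f : Matrix ι ι (K →L[ℂ] K)) i j =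
      algebraMap ℂ (K →L[ℂ] K) (f i * X i j * f j) := by
  rw [diagonalScalar_apply, Matrix.mul_diagonal, Matrix.diagonal_mul, map_mul, map_mul,
    Algebra.algebraMap_eq_smul_one (X i j)]
  rfl

omit [CompleteSpace K] in
lemma sum_powersetCard_noncommProd_diagonalScalar {c : ℕ} (f : Fin c → ι → ℂ) (b : ℕ)
    (hcomm : ∀ a a', Commute (diagonalScalar ι K (f a)) (diagonalScalar ι K (f a'))) :
    ∑ T ∈ (Finset.univ : Finset (Fin c)).powersetCard b,
      T.noncommProd (fun a => diagonalScalar ι K (f a)) (fun a _ a' _ _ => hcomm a a') =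
    diagonalScalar ι K
      (∑ T ∈ (Finset.univ : Finset (Fin c)).powersetCard b, ∏ a ∈ T, f a) := by
  rw [map_sum]
  refine Finset.sum_congr rfl fun T _ => ?_
  rw [← Finset.noncommProd_eq_prod]
  exact (Finset.map_noncommProd T f _ (diagonalScalar ι K)).symm

omit [Fintype ι] [DecidableEq ι] in
lemma sum_powersetCard_prod_indicator {c : ℕ} (φ : ι → Finset (Fin c)) (b : ℕ) (v : ι) :
    (∑ T ∈ (Finset.univ : Finset (Fin c)).powersetCard b,
      ∏ a ∈ T, fun v => if a ∈ φ v then (1 : ℂ) else 0) v = ((φ v).card.choose b : ℂ) := by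
  have h := sum_powersetCard_prod_mul (fun a => if a ∈ φ v then (1 : ℂ) else 0) 1 (φ v)
    (fun a => mul_one _) b
  rw [mul_one, nsmul_eq_mul, mul_one] at h
  simpa [Finset.sum_apply, Finset.prod_apply] using h

/-- Diagonal matrices with entries in the commutant of `N` commute with all elementary tensors,
hence with `X`. Coordinate projections make `X` diagonal; constant diagonals put its entries in the
bicommutant of `N`. -/
lemma vnTensor_diagonalMatrices {N : VonNeumannAlgebra K} {X : Matrix ι ι (K →L[ℂ] K)}
    (hX : X ∈ vnTensor (diagonalMatrices ι) N) : X.IsDiag ∧ ∀ i, X i i ∈ N := by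
  have key : ∀ d : ι → (K →L[ℂ] K), (∀ i, ∀ y ∈ N, y * d i = d i * y) →
      ∀ i j, d i * X i j = X i j * d j := by
    intro d hd i j
    have h : Matrix.diagonal d * X = X * Matrix.diagonal d := by
      refine hX _ ?_
      rintro _ ⟨m, hm, x, hx, rfl⟩
      ext1 k l
      rw [Matrix.mul_diagonal, Matrix.diagonal_mul]
      by_cases hkl : k = l
      · subst hkl
        simp [elemTensor, hd k x hx]
      · have : m k l = 0 := hm hkl
        simp [elemTensor, this]
    have h1 := congrFun (congrFun h i) j
    rwa [Matrix.mul_diagonal, Matrix.diagonal_mul] at h1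
  constructor
  · intro i j hij
    have h := key (Pi.single i 1) 
      (fun k y _ => by by_cases hk : k = i <;> simp [hk]) i j
    simpa [Pi.single_apply, hij.symm] using h
  · intro i
    have h : X i i ∈ Set.centralizer (Set.centralizer (N : Set (K →L[ℂ] K))) := fun d hd =>
      key (fun _ => d) (fun _ y hy => hd y hy) i i
    rwa [show Set.centralizer (Set.centralizer (N : Set (K →L[ℂ] K))) = N from
      N.centralizer_centralizer'] at h

lemma exists_diagonalScalar {N : VonNeumannAlgebra K} (hN : ColoringType.loc.Allows N)
    {X : Matrix ι ι (K →L[ℂ] K)} (hX : X ∈ vnTensor (diagonalMatrices ι) N) :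
    ∃ f : ι → ℂ, X = diagonalScalar ι K f := by
  have := hN.nontrivial
  have h1 : (1 : N.toStarSubalgebra) ≠ 0 := fun h => one_ne_zero (congrArg Subtype.val h)
  have h2 := (finrank_eq_one_iff_of_nonzero' 1 h1).1 hN.2
  obtain ⟨hdiag, hmem⟩ := vnTensor_diagonalMatrices hX
  choose f hf using fun i => h2 ⟨X i i, hmem i⟩
  refine ⟨f, ?_⟩
  rw [diagonalScalar_apply, ← hdiag.diagonal_diag]
  congr 1
  ext1 i
  rw [Algebra.algebraMap_eq_smul_one]
  exact (congrArg Subtype.val (hf i)).symm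

/-- The projection of color `a` is the indicator of the vertices that carry `a`, over the scalars
`scalarVN`. -/
lemma SimpleGraph.BFoldColorable.toQuantumGraph {G : SimpleGraph ι} {b c : ℕ}
    (h : G.BFoldColorable b c) : G.toQuantumGraph.BFoldColorable b .loc c := by
  obtain ⟨φ, hcard, hdisj⟩ := h
  let f : Fin c → ι → ℂ := fun a v => if a ∈ φ v then 1 else 0
  have hcomm : ∀ a a', Commute (diagonalScalar ι ℂ (f a)) (diagonalScalar ι ℂ (f a')) :=
    fun a a' => (Commute.all (f a) (f a')).map _
  refine ⟨ℂ, _, _, _, scalarVN, fun a => diagonalScalar ι ℂ (f a), allows_scalarVN,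
    fun a => ?_, fun a => ⟨?_, ?_⟩, hcomm, ?_, fun a X hX => ?_⟩
  · exact Set.subset_centralizer_centralizer
      ⟨_, Matrix.isDiag_diagonal (f a), 1, one_mem _, diagonalScalar_eq_elemTensor (f a)⟩
  · rw [IsIdempotentElem, ← map_mul]
    congr 1
    ext v
    simp [f]
  · rw [IsSelfAdjoint, diagonalScalar_apply, Matrix.star_eq_conjTranspose,
      Matrix.diagonal_conjTranspose]
    congr 1
    ext1 v
    change star (algebraMap ℂ (ℂ →L[ℂ] ℂ) (f a v)) = _
    rw [← algebraMap_star_comm]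
    simp only [f]
    split_ifs <;> simp
  · refine (sum_powersetCard_noncommProd_diagonalScalar f b hcomm).trans ?_
    rw [← map_one (diagonalScalar ι ℂ)]
    congr 1
    ext v
    rw [sum_powersetCard_prod_indicator, hcard]
    simp
  · have hX' := (mem_edgeSpan G X).1 hX
    ext1 i j
    rw [diagonalScalar_conj_apply]
    by_cases hij : G.Adj i j
    · have : ¬ (a ∈ φ i ∧ a ∈ φ j) := fun h => Finset.disjoint_left.1 (hdisj i j hij) h.1 h.2
      by_cases hi : a ∈ φ i <;> by_cases hj : a ∈ φ j <;> simp_all [f]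
    · simp [hX' i j hij]

lemma SimpleGraph.bFoldColorable_of_toQuantumGraph {G : SimpleGraph ι} {b c : ℕ}
    (hb : b ≠ 0) (h : G.toQuantumGraph.BFoldColorable b .loc c) : G.BFoldColorable b c := by
  obtain ⟨K, _, _, _, N, P, hN, hP⟩ := h
  have := hN.nontrivial
  choose f hf using fun a => exists_diagonalScalar hN (hP.mem a)
  obtain rfl : P = fun a => diagonalScalar ι K (f a) := funext hf
  have hf01 : ∀ a v, f a v = 0 ∨ f a v = 1 := by
    intro a v
    have h1 : f a * f a = f a := diagonalScalar_injective (K := K) (by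
      rw [map_mul]
      exact (hP.proj a).isIdempotentElem)
    exact IsIdempotentElem.iff_eq_zero_or_one.1 (congrFun h1 v)
  obtain ⟨φ, rfl⟩ : ∃ φ : ι → Finset (Fin c), f = fun a v => if a ∈ φ v then 1 else 0 := by
    refine ⟨fun v => Finset.univ.filter fun a => f a v = 1, ?_⟩
    ext a v
    obtain h | h := hf01 a v <;> simp [h]
  refine ⟨φ, fun v => ?_, fun v w hvw => Finset.disjoint_left.2 fun a hv hw => ?_⟩
  · have h1 := hP.sum_eq_one
    rw [sum_powersetCard_noncommProd_diagonalScalar, ← map_one (diagonalScalar ι K)] at h1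
    have h2 := congrFun (diagonalScalar_injective h1) v
    rw [sum_powersetCard_prod_indicator, Pi.one_apply, Nat.cast_eq_one,
      Nat.choose_eq_one_iff] at h2
    exact h2.resolve_left hb
  -- Tested on the matrix unit of the edge, the condition reads `f a v * f a w = 0` in the entry
  -- `(v, w)`.
  · have h1 := hP.edge a (Matrix.single v w 1) (Submodule.subset_span ⟨v, w, hvw, rfl⟩)
    have h2 := congrFun (congrFun h1 v) w
    rw [diagonalScalar_conj_apply] at h2
    simp [hv, hw] at h2

end Local

end

/-! ### The three statements on chromatic numbers -/

theorem proposition3 {ι : Type*} [Fintype ι] [DecidableEq ι] [Nonempty ι] (b : ℕ) :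
    -- the chromatic number of type `t` is the `1`-fold chromatic number of type `t`
    (∀ (𝒢 : QuantumGraph ι) (t : ColoringType),
      𝒢.chromaticNumber t = 𝒢.bFoldChromaticNumber 1 t) ∧
    -- for classical graphs the local `b`-fold chromatic number is the classical one
    (∀ G : SimpleGraph ι,
      G.toQuantumGraph.bFoldChromaticNumber b .loc = G.bFoldChromaticNumber b) ∧
    -- the `b`-fold chromatic number strictly increases with `b`, as long as it is not infinite
    (1 ≤ b → ∀ (𝒢 : QuantumGraph ι) (t : ColoringType),
      𝒢.bFoldChromaticNumber (b - 1) t < 𝒢.bFoldChromaticNumber b t ∨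
        (𝒢.bFoldChromaticNumber (b - 1) t = ⊤ ∧ 𝒢.bFoldChromaticNumber b t = ⊤)) := by
  refine ⟨fun 𝒢 t => ?_, fun G => ?_, fun hb 𝒢 t => ?_⟩
  · simp only [QuantumGraph.chromaticNumber, QuantumGraph.bFoldChromaticNumber,
      QuantumGraph.colorable_iff]
  · refine le_antisymm (le_iInf₂ fun c hc => ?_) ?_
    · exact iInf₂_le c (SimpleGraph.BFoldColorable.toQuantumGraph hc)
    -- For `b = 0` the operator identity says nothing about the sizes of the color sets, but the
    -- classical number is 0.
    · obtain rfl | hb := eq_or_ne b 0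
      · have h0 : G.BFoldColorable 0 0 :=
          ⟨fun _ => ∅, fun _ => rfl, fun _ _ _ => Finset.disjoint_empty_left _⟩
        exact (iInf₂_le 0 h0).trans (by simp)
      · exact le_iInf₂ fun c hc =>
          iInf₂_le c (SimpleGraph.bFoldColorable_of_toQuantumGraph hb hc)
  · obtain ⟨b, rfl⟩ : ∃ k, b = k + 1 := ⟨b - 1, by omega⟩
    rw [Nat.add_sub_cancel]
    by_cases h : ∃ c, 𝒢.BFoldColorable (b + 1) t c
    · left
      have hpred : ∀ c, 𝒢.BFoldColorable (b + 1) t c →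
          𝒢.bFoldChromaticNumber b t + 1 ≤ c := by
        intro c hc
        obtain ⟨d, rfl⟩ : ∃ d, c = d + 1 := ⟨c - 1, by have := hc.pos; omega⟩
        push_cast
        gcongr
        exact iInf₂_le d hc.pred
      -- Finiteness is needed to turn `n + 1 ≤ m` into `n < m` in `ℕ∞`.
      have hlt : 𝒢.bFoldChromaticNumber b t ≠ ⊤ := by
        obtain ⟨c, hc⟩ := h
        intro htop
        simpa [htop] using hpred c hc
      exact (ENat.add_one_le_iff hlt).1 (le_iInf₂ hpred)
    · have htop : 𝒢.bFoldChromaticNumber (b + 1) t = ⊤ :=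
        iInf₂_eq_top.2 fun c hc => absurd ⟨c, hc⟩ h
      rw [htop]
      by_cases h' : 𝒢.bFoldChromaticNumber b t = ⊤
      · exact Or.inr ⟨h', rfl⟩
      · exact Or.inl (lt_top_iff_ne_top.2 h')
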